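/- Let $q,a,b$ be nonzero complex numbers with $|q|<1$ and $\max\{|a|,|b|,|ab/q|\}<1$, let $\omega=e^{2\pi i/3}$, and let $q^{1/2}$ be any square root of $q$. Write $(x;q)_n=\prod_{k=0}^{n-1}(1-xq^k)$ for $n\in\{0,1,2,\dots\}\cup\{\infty\}$ and $(x_1,\dots,x_m;q)_n=(x_1;q)_n\cdots(x_m;q)_n$. Then the four series below converge absolutely, and \begin{align*} &\frac{(q,ab/q;q)_\infty}{(a,b;q)_\infty}\sum_{n=0}^{\infty}\frac{(q/a,q/b,\omega,\omega^2;q)_n}{(q,-1,q^{1/2},-q^{1/2};q)_n}\left(\frac{ab}{q}\right)^n\\ &\quad=1+\sum_{n=1}^{\infty}(-1)^n(1+q^{3n})\frac{(q/a,q/b;q)_{3n}}{(a,b;q)_{3n}}a^{3n}b^{3n}q^{\frac{9n^2-9n}{2}}\\ &\qquad+\frac{q^2}{2}\sum_{n=1}^{\infty}(-1)^n(1+q^{3n-1})\frac{(q/a,q/b;q)_{3n-1}}{(a,b;q)_{3n-1}}a^{3n-1}b^{3n-1}q^{\frac{9n^2-15n}{2}}\\ &\qquad+\frac{1}{2q}\sum_{n=0}^{\infty}(-1)^n(1+q^{3n+1})\frac{(q/a,q/b;q)_{3n+1}}{(a,b;q)_{3n+1}}a^{3n+1}b^{3n+1}q^{\frac{9n^2-3n}{2}}.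 \end{align*} -/

import Mathlib

noncomputable section

/-- The finite `q`-shifted factorial `(a; q)_n = ∏_{k=0}^{n-1} (1 - a q^k)`. -/
def qPoch (a q : ℂ) (n : ℕ) : ℂ := ∏ k ∈ Finset.range n, (1 - a * q ^ k)

/-- The infinite `q`-shifted factorial `(a; q)_∞ = ∏_{k=0}^∞ (1 - a q^k)`, used for `|q| < 1`. -/
def qPochInf (a q : ℂ) : ℂ := ∏' k : ℕ, (1 - a * q ^ k)

/-- The product in `qPochInf` converges for `|q| < 1`. -/
theorem multipliable_qPochInf (a q : ℂ) (hq : ‖q‖ < 1) :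
    Multipliable (fun k : ℕ => 1 - a * q ^ k) := by
  have h : Summable (fun k : ℕ => ‖-(a * q ^ k)‖) := by
    simp only [norm_neg, norm_mul, norm_pow]
    exact (summable_geometric_of_lt_one (norm_nonneg q) hq).mul_left _
  simpa [sub_eq_add_neg] using multipliable_one_add_of_summable h

/-- `(a; q)_∞` is the limit of `(a; q)_n` for `|q| < 1`. -/
theorem tendsto_qPoch (a q : ℂ) (hq : ‖q‖ < 1) :
    Filter.Tendsto (qPoch a q) Filter.atTop (nhds (qPochInf a q)) :=
  (multipliable_qPochInf a q hq).tendsto_prod_tprod_nat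

/-- The compact notation `(a₁, …, a_m; q)_n = (a₁; q)_n ⋯ (a_m; q)_n`. -/
def qPochs (l : List ℂ) (q : ℂ) (n : ℕ) : ℂ := (l.map fun a => qPoch a q n).prod

/-- The compact notation `(a₁, …, a_m; q)_∞ = (a₁; q)_∞ ⋯ (a_m; q)_∞`. -/
def qPochsInf (l : List ℂ) (q : ℂ) : ℂ := (l.map fun a => qPochInf a q).prod

/-- The `n`-th term of the series on the left-hand side; `s` is a square root of `q`. -/
def lhsTerm (q s a b ω : ℂ) (n : ℕ) : ℂ :=
  qPochs [q / a, q / b, ω, ω ^ 2] q n / qPochs [q, -1, s, -s] q n * (a * b / q) ^ n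

/-- The common factor
`(1 + q^m) (q/a, q/b; q)_m / (a, b; q)_m · a^m b^m` of the terms on the right-hand side. -/
def rhsFactor (q a b : ℂ) (m : ℕ) : ℂ :=
  (1 + q ^ m) * (qPochs [q / a, q / b] q m / qPochs [a, b] q m) * a ^ m * b ^ m

end

open Filter Topology Finset

/-! The identity is Bailey's lemma applied to a Bailey pair relative to `1`, that is, `β n = ∑ α r /
((q;q)_{n-r} (q;q)_{n+r})`. Throughout, a pair `(r, k)` on an antidiagonal stands for `n = r + k`,
so these denominators appear at the indices `k` and `2 * r + k`.

The finite Jacobi triple product (`sum_antidiagonal_thetaTerm`) says that the theta terms in `z`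
form such an `α`, with `β n = (z, q/z; q)_n / (q;q)_{2n}`. Averaging over `z = ω` and `z = ω⁻¹` and
using `1 + ω + ω² = 0` turns `β` into the quotient on the left-hand side
(`sum_antidiagonal_baileyAlpha`), while `α r` becomes `(-1)^r q^(r(r-1)/2) (1 + q^r) (ω^r + ω^(-r))
/ 2` for `r ≥ 1`.

Bailey's lemma with `u = q/a`, `v = q/b`, `x = ab/q` follows by exchanging summations and evaluating
the inner sum by the `q`-Gauss sum. Finally `(ω^r + ω^(-r)) / 2` is `1` if `3 ∣ r` and `-1/2`
otherwise, so splitting by `r` mod 3 yields the three series. -/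

/-! ### Shifted factorials: recurrences, nonvanishing, bounds -/

theorem qPoch_zero (a q : ℂ) : qPoch a q 0 = 1 := by simp [qPoch]

theorem qPoch_succ (a q : ℂ) (n : ℕ) : qPoch a q (n + 1) = qPoch a q n * (1 - a * q ^ n) := by
  simp [qPoch, prod_range_succ]

theorem qPoch_add (a q : ℂ) (m n : ℕ) :
    qPoch a q (m + n) = qPoch a q m * qPoch (a * q ^ m) q n := by
  simp [qPoch, prod_range_add, pow_add, mul_assoc]

theorem qPoch_succ' (a q : ℂ) (n : ℕ) : qPoch a q (n + 1) = (1 - a) * qPoch (a * q) q n := by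
  rw [add_comm, qPoch_add]; simp [qPoch]

theorem qPoch_ne_zero {a q : ℂ} (h : ∀ k : ℕ, 1 - a * q ^ k ≠ 0) (n : ℕ) : qPoch a q n ≠ 0 :=
  prod_ne_zero_iff.2 fun k _ => h k

theorem one_sub_mul_pow_ne_zero {a q : ℂ} (ha : ‖a‖ < 1) (hq : ‖q‖ < 1) (k : ℕ) :
    1 - a * q ^ k ≠ 0 := by
  intro h
  have h1 : ‖a * q ^ k‖ = 1 := by rw [← sub_eq_zero.1 h]; simp
  rw [norm_mul, norm_pow] at h1
  have h2 : ‖q‖ ^ k ≤ 1 := pow_le_one₀ (norm_nonneg _) hq.le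
  nlinarith [norm_nonneg a, norm_nonneg q]

theorem qPochInf_eq_qPoch_mul (a q : ℂ) (hq : ‖q‖ < 1) (n : ℕ) :
    qPochInf a q = qPoch a q n * qPochInf (a * q ^ n) q := by
  have h1 := (tendsto_qPoch (a * q ^ n) q hq).const_mul (qPoch a q n)
  have h2 := (tendsto_qPoch a q hq).comp (tendsto_add_atTop_nat n)
  refine tendsto_nhds_unique h2 (h1.congr fun m => ?_)
  simp [← qPoch_add, add_comm]

theorem qPochInf_ne_zero {a q : ℂ} (hq : ‖q‖ < 1) (h : ∀ k : ℕ, 1 - a * q ^ k ≠ 0) :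
    qPochInf a q ≠ 0 := by
  have hs : Summable (fun k : ℕ => ‖-(a * q ^ k)‖) := by
    simp only [norm_neg, norm_mul, norm_pow]
    exact (summable_geometric_of_lt_one (norm_nonneg q) hq).mul_left _
  have := tprod_one_add_ne_zero_of_summable (f := fun k : ℕ => -(a * q ^ k))
    (fun k => by simpa [sub_eq_add_neg] using h k) hs
  simpa [sub_eq_add_neg, qPochInf] using this

theorem exists_norm_qPoch_le (a q : ℂ) (hq : ‖q‖ < 1) : ∃ K : ℝ, 0 < K ∧ ∀ n, ‖qPoch a q n‖ ≤ K := by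
  obtain ⟨K, hK⟩ := (tendsto_qPoch a q hq).norm.bddAbove_range
  exact ⟨max K 1, by positivity, fun n => le_max_of_le_left (hK ⟨n, rfl⟩)⟩

theorem exists_norm_inv_qPoch_le {a q : ℂ} (hq : ‖q‖ < 1) (h : ∀ k : ℕ, 1 - a * q ^ k ≠ 0) :
    ∃ K : ℝ, 0 < K ∧ ∀ n, ‖(qPoch a q n)⁻¹‖ ≤ K := by
  obtain ⟨K, hK⟩ := ((tendsto_qPoch a q hq).inv₀ (qPochInf_ne_zero hq h)).norm.bddAbove_range
  exact ⟨max K 1, by positivity, fun n => le_max_of_le_left (hK ⟨n, rfl⟩)⟩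

/-! ### The `q`-Gauss sum -/

/-- The terms of the `q`-Gauss series with parameters `A`, `B`, `C` and argument `x`. -/
noncomputable def gaussTerm (q A B C x : ℂ) (n : ℕ) : ℂ :=
  qPoch A q n * qPoch B q n * (qPoch q q n)⁻¹ * (qPoch C q n)⁻¹ * x ^ n

/-- A bound on the terms of the `q`-Gauss series that is uniform under the shifts `C ↦ C q ^ N`. -/
theorem exists_norm_gaussTerm_le {q : ℂ} (A B : ℂ) {C : ℂ} (hq : ‖q‖ < 1)
    (hC : ∀ k : ℕ, 1 - C * q ^ k ≠ 0) :
    ∃ K : ℝ, ∀ (N n : ℕ) (x : ℂ), ‖gaussTerm q A B (C * q ^ N) x n‖ ≤ K * ‖x‖ ^ n := by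
  obtain ⟨KA, hA0, hA⟩ := exists_norm_qPoch_le A q hq
  obtain ⟨KB, hB0, hB⟩ := exists_norm_qPoch_le B q hq
  obtain ⟨KC, hC0, hC1⟩ := exists_norm_qPoch_le C q hq
  obtain ⟨KQ, hQ0, hQ⟩ := exists_norm_inv_qPoch_le hq (one_sub_mul_pow_ne_zero hq hq)
  obtain ⟨KD, hD0, hD⟩ := exists_norm_inv_qPoch_le hq hC
  refine ⟨KA * KB * KQ * (KC * KD), fun N n x => ?_⟩
  -- Writing the shifted denominator through `C` itself makes the bound independent of `N`.
  have h : (qPoch (C * q ^ N) q n)⁻¹ = qPoch C q N * (qPoch C q (N + n))⁻¹ := by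
    rw [qPoch_add, mul_inv, mul_inv_cancel_left₀ (qPoch_ne_zero hC N)]
  rw [gaussTerm, h]
  simp only [norm_mul, norm_pow]
  gcongr
  exacts [hA n, hB n, hQ n, hC1 N, hD _]

theorem summable_gaussTerm {q : ℂ} (A B : ℂ) {C x : ℂ} (hq : ‖q‖ < 1) (hx : ‖x‖ < 1)
    (hC : ∀ k : ℕ, 1 - C * q ^ k ≠ 0) : Summable (gaussTerm q A B C x) := by
  obtain ⟨K, hK⟩ := exists_norm_gaussTerm_le A B hq hC
  refine Summable.of_norm_bounded
    ((summable_geometric_of_lt_one (norm_nonneg x) hx).mul_left K) fun n => ?_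
  simpa using hK 0 n x

/-- The right-hand side is a difference of consecutive values of `(1 - q ^ n) * gaussTerm`, so
summing over `n` telescopes and relates the series at `x` to the one at `x * q`. -/
theorem gaussTerm_contiguous {q : ℂ} (A B x : ℂ) (hq : ‖q‖ < 1)
    (hC : ∀ k : ℕ, 1 - A * B * x * q ^ k ≠ 0) (n : ℕ) :
    (1 - A * B * x) * (1 - x) * gaussTerm q A B (A * B * x) x n
      - (1 - A * x) * (1 - B * x) * gaussTerm q A B (A * B * x * q) (x * q) n
    = (1 - A * B * x) * ((1 - q ^ n) * gaussTerm q A B (A * B * x) x n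
      - (1 - q ^ (n + 1)) * gaussTerm q A B (A * B * x) x (n + 1)) := by
  have h0 : 1 - A * B * x ≠ 0 := by simpa using hC 0
  have hn := hC n
  have hQ := one_sub_mul_pow_ne_zero hq hq n
  have e1 : (qPoch (A * B * x * q) q n)⁻¹
      = (1 - A * B * x) * ((1 - A * B * x * q ^ n)⁻¹ * (qPoch (A * B * x) q n)⁻¹) := by
    have := qPoch_succ' (A * B * x) q n
    rw [qPoch_succ] at this
    rw [← mul_inv, mul_comm (1 - A * B * x * q ^ n), this, mul_inv, mul_inv_cancel_left₀ h0]
  have hu := mul_inv_cancel₀ hQ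
  have hv := mul_inv_cancel₀ hn
  simp only [gaussTerm, e1, qPoch_succ, mul_inv, mul_pow]
  linear_combination (1 - A * B * x) * qPoch A q n * qPoch B q n * (qPoch q q n)⁻¹
    * (qPoch (A * B * x) q n)⁻¹ * x ^ n * ((1 - A * q ^ n) * (1 - B * q ^ n)
    * (1 - A * B * x * q ^ n)⁻¹ * x * hu - (q ^ n - x) * hv)

theorem tsum_gaussTerm_contiguous {q : ℂ} (A B x : ℂ) (hq : ‖q‖ < 1) (hx : ‖x‖ < 1)
    (hC : ∀ k : ℕ, 1 - A * B * x * q ^ k ≠ 0) :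
    (1 - A * B * x) * (1 - x) * ∑' n, gaussTerm q A B (A * B * x) x n
      = (1 - A * x) * (1 - B * x) * ∑' n, gaussTerm q A B (A * B * x * q) (x * q) n := by
  have hs := summable_gaussTerm A B hq hx hC
  have hxq : ‖x * q‖ < 1 := by
    rw [norm_mul]; nlinarith [norm_nonneg x, norm_nonneg q]
  have hs' : Summable (gaussTerm q A B (A * B * x * q) (x * q)) := by
    refine summable_gaussTerm A B hq hxq fun k => ?_
    simpa [pow_succ', mul_assoc] using hC (k + 1)
  set g : ℕ → ℂ := fun n => (1 - q ^ n) * gaussTerm q A B (A * B * x) x n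
  have hg : Tendsto g atTop (𝓝 0) := by
    have h1 : Tendsto (fun n : ℕ => 1 - q ^ n) atTop (𝓝 (1 - 0)) :=
      (tendsto_pow_atTop_nhds_zero_of_norm_lt_one hq).const_sub 1
    simpa using h1.mul hs.tendsto_atTop_zero
  have h1 := (((hs.hasSum.mul_left ((1 - A * B * x) * (1 - x))).sub
    (hs'.hasSum.mul_left ((1 - A * x) * (1 - B * x)))).tendsto_sum_nat)
  -- Both ends of the telescope vanish: `g 0 = 0` because `1 - q ^ 0 = 0`, and `g n` tends to `0`.
  have h2 : Tendsto (fun n => (1 - A * B * x) * (g 0 - g n)) atTop (𝓝 0) := by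
    simpa [g] using (hg.const_sub (g 0)).const_mul (1 - A * B * x)
  refine sub_eq_zero.1 (tendsto_nhds_unique h1 (h2.congr fun n => ?_))
  rw [← sum_range_sub', mul_sum]
  exact sum_congr rfl fun k _ => (gaussTerm_contiguous A B x hq hC k).symm

theorem tsum_gaussTerm_iterate {q : ℂ} (A B x : ℂ) (hq : ‖q‖ < 1) (hx : ‖x‖ < 1)
    (hC : ∀ k : ℕ, 1 - A * B * x * q ^ k ≠ 0) (N : ℕ) :
    qPoch (A * B * x) q N * qPoch x q N * ∑' n, gaussTerm q A B (A * B * x) x n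
      = qPoch (A * x) q N * qPoch (B * x) q N
        * ∑' n, gaussTerm q A B (A * B * x * q ^ N) (x * q ^ N) n := by
  induction N with
  | zero => simp [qPoch_zero]
  | succ N ih =>
    have hxq : ‖x * q ^ N‖ < 1 := by
      have : ‖q‖ ^ N ≤ 1 := pow_le_one₀ (norm_nonneg _) hq.le
      rw [norm_mul, norm_pow]; nlinarith [norm_nonneg x]
    have h := tsum_gaussTerm_contiguous A B (x * q ^ N) hq hxq fun k => by
      simpa [pow_add, mul_assoc] using hC (N + k)
    simp only [qPoch_succ, pow_succ, ← mul_assoc] at h ⊢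
    linear_combination (1 - A * B * x * q ^ N) * (1 - x * q ^ N) * ih
      + qPoch (A * x) q N * qPoch (B * x) q N * h

/-- The `q`-Gauss sum. -/
theorem tsum_gaussTerm {q : ℂ} (A B x : ℂ) (hq : ‖q‖ < 1) (hx : ‖x‖ < 1)
    (hC : ∀ k : ℕ, 1 - A * B * x * q ^ k ≠ 0) :
    qPochInf (A * B * x) q * qPochInf x q * ∑' n, gaussTerm q A B (A * B * x) x n
      = qPochInf (A * x) q * qPochInf (B * x) q := by
  -- As `N → ∞` the argument `x * q ^ N` tends to `0`, so only the constant term of the series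
  -- survives.
  have hlim : Tendsto (fun N : ℕ => ∑' n, gaussTerm q A B (A * B * x * q ^ N) (x * q ^ N) n) atTop
      (𝓝 (∑' n : ℕ, if n = 0 then 1 else 0)) := by
    obtain ⟨K, hK⟩ := exists_norm_gaussTerm_le A B hq hC
    have hK0 : 0 ≤ K := by simpa using (norm_nonneg _).trans (hK 0 0 x)
    refine tendsto_tsum_of_dominated_convergence
      ((summable_geometric_of_lt_one (norm_nonneg x) hx).mul_left K) (fun n => ?_)
      (Eventually.of_forall fun N n => ?_)
    · rcases n.eq_zero_or_pos with rfl | hn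
      · simp [gaussTerm, qPoch_zero]
      · rw [if_neg hn.ne']
        have h1 : Tendsto (fun N : ℕ => x * q ^ N) atTop (𝓝 0) := by
          simpa using (tendsto_pow_atTop_nhds_zero_of_norm_lt_one hq).const_mul x
        have h2 : Tendsto (fun N : ℕ => K * ‖x * q ^ N‖ ^ n) atTop (𝓝 0) := by
          simpa [hn.ne'] using (h1.norm.pow n).const_mul K
        exact squeeze_zero_norm (fun N => hK N n _) h2
    · refine (hK N n _).trans ?_
      gcongr
      rw [norm_mul, norm_pow]
      exact mul_le_of_le_one_right (norm_nonneg _) (pow_le_one₀ (norm_nonneg _) hq.le)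
  rw [tsum_ite_eq] at hlim
  have h1 := ((tendsto_qPoch (A * B * x) q hq).mul (tendsto_qPoch x q hq)).mul_const
    (∑' n, gaussTerm q A B (A * B * x) x n)
  have h2 := ((tendsto_qPoch (A * x) q hq).mul (tendsto_qPoch (B * x) q hq)).mul hlim
  rw [mul_one] at h2
  exact tendsto_nhds_unique h1
    (h2.congr fun N => (tsum_gaussTerm_iterate A B x hq hx hC N).symm)

/-! ### The finite Jacobi triple product -/

/-- The `q`-binomial theorem, divided by `(q; q)_n`. -/
theorem sum_antidiagonal_qPoch_inv {q : ℂ} (hq : ‖q‖ < 1) (n : ℕ) (z : ℂ) :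
    ∑ p ∈ antidiagonal n, (-1) ^ p.1 * q ^ p.1.choose 2 * z ^ p.1
      * (qPoch q q p.1)⁻¹ * (qPoch q q p.2)⁻¹ = qPoch z q n * (qPoch q q n)⁻¹ := by
  induction n generalizing z with
  | zero => simp [qPoch_zero]
  | succ n ih =>
    have hne := one_sub_mul_pow_ne_zero hq hq
    refine mul_left_cancel₀ (hne n) ?_
    have hinv : ∀ m, (1 - q * q ^ m) * (qPoch q q (m + 1))⁻¹ = (qPoch q q m)⁻¹ := fun m => by
      rw [qPoch_succ, mul_inv_rev, mul_inv_cancel_left₀ (hne m)]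
    set f : ℕ × ℕ → ℂ := fun p => (-1) ^ p.1 * q ^ p.1.choose 2 * z ^ p.1
      * (qPoch q q p.1)⁻¹ * (qPoch q q p.2)⁻¹ with hf
    -- For `i + j = n + 1`, `1 - q^(n+1) = (1 - q^i) + q^i (1 - q^j)`; each piece lowers one of the
    -- two factorials by one.
    have h1 : (1 - q * q ^ n) * ∑ p ∈ antidiagonal (n + 1), f p
        = ∑ p ∈ antidiagonal (n + 1), (1 - q ^ p.1) * f p
          + ∑ p ∈ antidiagonal (n + 1), q ^ p.1 * (1 - q ^ p.2) * f p := by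
      rw [mul_sum, ← sum_add_distrib]
      refine sum_congr rfl fun p hp => ?_
      rw [← pow_succ', ← mem_antidiagonal.1 hp, pow_add]
      ring
    rw [h1, Nat.sum_antidiagonal_succ,
      Nat.sum_antidiagonal_succ' (f := fun p => q ^ p.1 * (1 - q ^ p.2) * f p)]
    simp only [pow_zero, sub_self, zero_mul, mul_zero, zero_add]
    rw [← sum_add_distrib]
    calc _ = ∑ p ∈ antidiagonal n, (1 - z) * ((-1) ^ p.1 * q ^ p.1.choose 2 * (z * q) ^ p.1
            * (qPoch q q p.1)⁻¹ * (qPoch q q p.2)⁻¹) := by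
          refine sum_congr rfl fun p _ => ?_
          have hc : (p.1 + 1).choose 2 = p.1.choose 2 + p.1 := by
            rw [Nat.choose_succ_succ' p.1 1, Nat.choose_one_right, add_comm]
          have e1 := hinv p.1
          have e2 := hinv p.2
          simp only [hf, hc, pow_add, pow_one, mul_pow]
          linear_combination (-(-1) ^ p.1 * q ^ p.1.choose 2 * q ^ p.1 * z ^ p.1 * z
            * (qPoch q q p.2)⁻¹) * e1
            + ((-1) ^ p.1 * q ^ p.1.choose 2 * q ^ p.1 * z ^ p.1 * (qPoch q q p.1)⁻¹) * e2
      _ = _ := by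
          rw [← mul_sum, ih, qPoch_succ']
          linear_combination -((1 - z) * qPoch (z * q) q n) * hinv n

/-- Reverse the product: `1 - z q^(-k) = -z q^(-k) (1 - (q/z) q^(k-1))` for `k = 1, …, n`. -/
theorem qPoch_mul_inv_pow {q z : ℂ} (hq0 : q ≠ 0) (hz : z ≠ 0) (n : ℕ) :
    (-1) ^ n * q ^ (n + 1).choose 2 * z⁻¹ ^ n * qPoch (z * q⁻¹ ^ n) q n = qPoch (q / z) q n := by
  induction n with
  | zero => simp [qPoch_zero]
  | succ n ih =>
    have hc : (n + 1 + 1).choose 2 = (n + 1).choose 2 + (n + 1) := by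
      rw [Nat.choose_succ_succ' (n + 1) 1, Nat.choose_one_right, add_comm]
    have e : z * q⁻¹ ^ (n + 1) * q = z * q⁻¹ ^ n := by
      rw [pow_succ, ← mul_assoc, inv_mul_cancel_right₀ hq0]
    rw [qPoch_succ', e, qPoch_succ (q / z), ← ih, hc]
    have h3 : z⁻¹ * (q ^ (n + 1) * (1 - z * q⁻¹ ^ (n + 1))) = q / z * q ^ n - 1 := by
      have h4 : q ^ (n + 1) * q⁻¹ ^ (n + 1) = 1 := by
        rw [← mul_pow, mul_inv_cancel₀ hq0, one_pow]
      have h5 := inv_mul_cancel₀ hz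
      rw [div_eq_mul_inv]
      linear_combination (-(z⁻¹ * z)) * h4 - h5
    simp only [pow_add _ ((n + 1).choose 2), pow_succ (-1 : ℂ), pow_succ z⁻¹]
    linear_combination (-(-1) ^ n * q ^ (n + 1).choose 2 * z⁻¹ ^ n * qPoch (z * q⁻¹ ^ n) q n) * h3

theorem choose_two_add (n r : ℕ) :
    (n + r).choose 2 + (n + 1).choose 2 = n * (n + r) + r.choose 2 := by
  induction n with
  | zero => simp
  | succ n ih =>
    have h1 : (n + 1 + r).choose 2 = (n + r) + (n + r).choose 2 := by
      rw [add_right_comm, Nat.choose_succ_succ' (n + r) 1, Nat.choose_one_right]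
    have h2 : (n + 1 + 1).choose 2 = (n + 1) + (n + 1).choose 2 := by
      rw [Nat.choose_succ_succ' (n + 1) 1, Nat.choose_one_right]
    rw [h1, h2]; linarith

/-- The sum of the terms of index `r` and `-r` of `∑ (-1)^r q^(r(r-1)/2) z^r`. -/
noncomputable def thetaTerm (q z : ℂ) (r : ℕ) : ℂ :=
  -- At `r = 0` the indices `r` and `-r` coincide and are counted once.
  if r = 0 then 1 else (-1) ^ r * q ^ r.choose 2 * (z ^ r + q ^ r * z⁻¹ ^ r)

/-- The finite form of the Jacobi triple product identity. -/
theorem sum_antidiagonal_thetaTerm {q z : ℂ} (hq0 : q ≠ 0) (hq : ‖q‖ < 1) (hz : z ≠ 0) (n : ℕ) :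
    ∑ p ∈ antidiagonal n, thetaTerm q z p.1 * (qPoch q q p.2)⁻¹ * (qPoch q q (2 * p.1 + p.2))⁻¹
      = qPoch z q n * qPoch (q / z) q n * (qPoch q q (2 * n))⁻¹ := by
  -- The `q`-binomial theorem of order `2n` at `z q^(-n)` has terms `F k`. Multiplied by `c`, it is
  -- centred at `k = n`, and `k = n ± r` become the theta terms of index `± r`.
  set c : ℂ := (-1) ^ n * q ^ (n + 1).choose 2 * z⁻¹ ^ n with hc
  set F : ℕ → ℂ := fun k => (-1) ^ k * q ^ k.choose 2 * (z * q⁻¹ ^ n) ^ k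
    * (qPoch q q k)⁻¹ * (qPoch q q (2 * n - k))⁻¹ with hF
  have hm : ∀ k : ℕ, ((-1) ^ k * (-1) ^ k : ℂ) = 1 := fun k => by rw [← mul_pow]; simp
  have hzk : ∀ k : ℕ, z⁻¹ ^ k * z ^ k = 1 := fun k => by
    rw [← mul_pow, inv_mul_cancel₀ hz, one_pow]
  have hplus : ∀ r ≤ n, c * F (n + r) = (-1) ^ r * q ^ r.choose 2 * z ^ r
      * (qPoch q q (n + r))⁻¹ * (qPoch q q (n - r))⁻¹ := fun r hr => by
    have e : q ^ (n + 1).choose 2 * q ^ (n + r).choose 2 * (q⁻¹ ^ n) ^ (n + r) = q ^ r.choose 2 := by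
      rw [← pow_add, add_comm, choose_two_add, pow_add, ← pow_mul, inv_pow]
      field_simp
    have hsub : 2 * n - (n + r) = n - r := by omega
    simp only [hF, hc, hsub, mul_pow, ← e]
    rw [pow_add (-1 : ℂ), pow_add z]
    have h1 : ((-1) ^ n * (-1) ^ n) * (z⁻¹ ^ n * z ^ n) = 1 := by rw [hm, hzk, one_mul]
    linear_combination ((-1) ^ r * q ^ (n + 1).choose 2 * q ^ (n + r).choose 2
      * (q⁻¹ ^ n) ^ (n + r) * z ^ r * (qPoch q q (n + r))⁻¹ * (qPoch q q (n - r))⁻¹)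
      * h1
  have hminus : ∀ r ≤ n, c * F (n - r) = (-1) ^ r * q ^ r.choose 2 * (q ^ r * z⁻¹ ^ r)
      * (qPoch q q (n + r))⁻¹ * (qPoch q q (n - r))⁻¹ := fun r hr => by
    obtain ⟨i, rfl⟩ := Nat.exists_eq_add_of_le' hr
    have e : q ^ (i + r + 1).choose 2 * q ^ i.choose 2 * (q⁻¹ ^ (i + r)) ^ i
        = q ^ r.choose 2 * q ^ r := by
      have h1 := choose_two_add i r
      have h2 : (i + r + 1).choose 2 + i.choose 2 = i * (i + r) + (r.choose 2 + r) := by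
        rw [Nat.choose_succ_succ' i 1, Nat.choose_one_right] at h1
        rw [Nat.choose_succ_succ' (i + r) 1, Nat.choose_one_right]
        linarith
      rw [← pow_add, h2, pow_add, pow_add, ← pow_mul, inv_pow, mul_comm i]
      field_simp
    have hsub : 2 * (i + r) - i = i + r + r := by omega
    simp only [hF, hc, hsub, mul_pow, Nat.add_sub_cancel]
    have h1 : ((-1) ^ i * (-1) ^ i) * (z⁻¹ ^ i * z ^ i) = 1 := by rw [hm, hzk, one_mul]
    rw [pow_add (-1 : ℂ), pow_add z⁻¹]
    linear_combination ((-1) ^ r * z⁻¹ ^ r * (qPoch q q (i + r + r))⁻¹ * (qPoch q q i)⁻¹) * e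
      + ((-1) ^ r * z⁻¹ ^ r * (qPoch q q (i + r + r))⁻¹ * (qPoch q q i)⁻¹
        * q ^ (i + r + 1).choose 2 * q ^ i.choose 2 * (q⁻¹ ^ (i + r)) ^ i) * h1
  have hsum : c * ∑ k ∈ range (2 * n + 1), F k = ∑ r ∈ range (n + 1),
      thetaTerm q z r * (qPoch q q (n - r))⁻¹ * (qPoch q q (2 * r + (n - r)))⁻¹ := by
    have h1 : ∑ k ∈ range (2 * n + 1), F k
        = ∑ r ∈ range n, (F (n + (r + 1)) + F (n - (r + 1))) + F (n + 0) := by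
      rw [show 2 * n + 1 = n + (n + 1) by ring, sum_range_add, sum_range_succ', sum_add_distrib,
        ← sum_range_reflect]
      have : ∀ r ∈ range n, F (n - 1 - r) = F (n - (r + 1)) := fun r _ => by
        rw [Nat.sub_sub, add_comm]
      rw [sum_congr rfl this]; ring
    rw [h1, sum_range_succ', mul_add, mul_sum]
    congr 1
    · refine sum_congr rfl fun r hr => ?_
      have hr' : r + 1 ≤ n := mem_range.1 hr
      rw [mul_add, hplus _ hr', hminus _ hr', thetaTerm, if_neg (by omega),
        show 2 * (r + 1) + (n - (r + 1)) = n + (r + 1) by omega]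
      ring
    · rw [hplus 0 n.zero_le]; simp [thetaTerm]
  rw [Nat.sum_antidiagonal_eq_sum_range_succ_mk, ← hsum, hF,
    ← Nat.sum_antidiagonal_eq_sum_range_succ_mk (fun p => (-1) ^ p.1 * q ^ p.1.choose 2 *
      (z * q⁻¹ ^ n) ^ p.1 * (qPoch q q p.1)⁻¹ * (qPoch q q p.2)⁻¹),
    sum_antidiagonal_qPoch_inv hq, two_mul, qPoch_add (z * q⁻¹ ^ n)]
  have e : z * q⁻¹ ^ n * q ^ n = z := by
    rw [mul_assoc, ← mul_pow, inv_mul_cancel₀ hq0, one_pow, mul_one]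
  rw [e, ← qPoch_mul_inv_pow hq0 hz]
  ring

/-! ### Bailey's lemma -/

theorem hasSum_sum_antidiagonal {f : ℕ × ℕ → ℂ} (hf : Summable f) :
    HasSum (fun n => ∑ p ∈ antidiagonal n, f p) (∑' r, ∑' k, f (r, k)) := by
  rw [← hf.tsum_prod]
  have h := HasAntidiagonal.sigmaAntidiagonalEquivProd.hasSum_iff.2 hf.hasSum
  refine h.sigma fun n => ?_
  rw [← sum_coe_sort]
  exact hasSum_fintype _

theorem summable_bailey {q u v x : ℂ} {α : ℕ → ℂ} {M : ℝ} (hq : ‖q‖ < 1) (hx : ‖x‖ < 1)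
    (hα : ∀ r, ‖α r‖ ≤ M) :
    Summable (fun p : ℕ × ℕ => qPoch u q (p.1 + p.2) * qPoch v q (p.1 + p.2) * x ^ (p.1 + p.2)
      * (α p.1 * (qPoch q q p.2)⁻¹ * (qPoch q q (2 * p.1 + p.2))⁻¹)) := by
  obtain ⟨KU, hU0, hU⟩ := exists_norm_qPoch_le u q hq
  obtain ⟨KV, hV0, hV⟩ := exists_norm_qPoch_le v q hq
  obtain ⟨KQ, hQ0, hQ⟩ := exists_norm_inv_qPoch_le hq (one_sub_mul_pow_ne_zero hq hq)
  have hg := summable_geometric_of_lt_one (norm_nonneg x) hx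
  have hM : 0 ≤ M := (norm_nonneg _).trans (hα 0)
  refine Summable.of_norm_bounded
    ((hg.mul_of_nonneg hg (fun _ => by positivity) fun _ => by positivity).mul_left
      (KU * KV * (M * KQ * KQ))) fun p => ?_
  have e : KU * KV * (M * KQ * KQ) * (‖x‖ ^ p.1 * ‖x‖ ^ p.2)
      = KU * KV * ‖x‖ ^ (p.1 + p.2) * (M * KQ * KQ) := by rw [pow_add]; ring
  rw [e]
  simp only [norm_mul, norm_pow]
  gcongr
  exacts [hU _, hV _, hα _, hQ _, hQ _]

/-- Bailey's lemma for a Bailey pair relative to `1` with bounded `α`. -/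
theorem bailey_lemma {q u v x : ℂ} {α : ℕ → ℂ} {M : ℝ} (hq : ‖q‖ < 1) (hx : ‖x‖ < 1)
    (hα : ∀ r, ‖α r‖ ≤ M) (huv : u * v * x = q)
    (hu : ∀ k : ℕ, 1 - u * x * q ^ k ≠ 0) (hv : ∀ k : ℕ, 1 - v * x * q ^ k ≠ 0) :
    qPochInf q q * qPochInf x q * ∑' n, qPoch u q n * qPoch v q n * x ^ n
        * ∑ p ∈ antidiagonal n, α p.1 * (qPoch q q p.2)⁻¹ * (qPoch q q (2 * p.1 + p.2))⁻¹
      = qPochInf (u * x) q * qPochInf (v * x) q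
        * ∑' r, qPoch u q r * qPoch v q r * (qPoch (u * x) q r)⁻¹ * (qPoch (v * x) q r)⁻¹
          * x ^ r * α r := by
  have h1 : ∀ n, qPoch u q n * qPoch v q n * x ^ n
        * ∑ p ∈ antidiagonal n, α p.1 * (qPoch q q p.2)⁻¹ * (qPoch q q (2 * p.1 + p.2))⁻¹
      = ∑ p ∈ antidiagonal n, qPoch u q (p.1 + p.2) * qPoch v q (p.1 + p.2) * x ^ (p.1 + p.2)
        * (α p.1 * (qPoch q q p.2)⁻¹ * (qPoch q q (2 * p.1 + p.2))⁻¹) := fun n => by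
    rw [mul_sum]
    exact sum_congr rfl fun p hp => by rw [mem_antidiagonal.1 hp]
  rw [tsum_congr h1, (hasSum_sum_antidiagonal (summable_bailey hq hx hα)).tsum_eq, ← tsum_mul_left,
    ← tsum_mul_left]
  refine tsum_congr fun r => ?_
  have hqq := one_sub_mul_pow_ne_zero hq hq
  -- Since `u v x = q`, the denominator parameter `q^(2r+1)` left by `(q;q)_{2r+k}` is exactly the
  -- one the `q`-Gauss sum requires.
  have hC : u * q ^ r * (v * q ^ r) * x = q * q ^ (2 * r) := by rw [two_mul, pow_add, ← huv]; ring
  have h2 : ∀ k, qPoch u q (r + k) * qPoch v q (r + k) * x ^ (r + k)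
        * (α r * (qPoch q q k)⁻¹ * (qPoch q q (2 * r + k))⁻¹)
      = qPoch u q r * qPoch v q r * x ^ r * α r * (qPoch q q (2 * r))⁻¹
        * gaussTerm q (u * q ^ r) (v * q ^ r) (u * q ^ r * (v * q ^ r) * x) x k := fun k => by
    rw [hC, gaussTerm, qPoch_add u, qPoch_add v, qPoch_add q q (2 * r), mul_inv, pow_add]
    ring
  rw [tsum_congr h2, tsum_mul_left]
  have hG := tsum_gaussTerm (u * q ^ r) (v * q ^ r) x hq hx fun k => by
    rw [hC, mul_assoc, ← pow_add]; exact hqq _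
  have e1 := qPochInf_eq_qPoch_mul q q hq (2 * r)
  have e2 := qPochInf_eq_qPoch_mul (u * x) q hq r
  have e3 := qPochInf_eq_qPoch_mul (v * x) q hq r
  rw [← hC] at e1
  rw [mul_right_comm u _ x, mul_right_comm v _ x] at hG
  have n1 := mul_inv_cancel₀ (qPoch_ne_zero hqq (2 * r))
  have n2 := mul_inv_cancel₀ (qPoch_ne_zero hu r)
  have n3 := mul_inv_cancel₀ (qPoch_ne_zero hv r)
  rw [e1, e2, e3]
  generalize u * q ^ r * (v * q ^ r) * x = c at *
  generalize ∑' n, gaussTerm q (u * q ^ r) (v * q ^ r) c x n = S at *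
  linear_combination (qPoch u q r * qPoch v q r * x ^ r * α r) * (qPochInf c q * qPochInf x q * S * n1
    + hG - qPochInf (u * x * q ^ r) q * qPochInf (v * x * q ^ r) q
      * (qPoch (v * x) q r * (qPoch (v * x) q r)⁻¹ * n2 + n3))

/-! ### The Bailey pair built from the cube roots of unity -/

/-- The factors with `± s` give the odd powers `1 - q^(2k+1)`. The factor `1 + q ^ n` completes
`(-1;q)_n` to `2 (-q;q)_n`, which with `(q;q)_n` gives the even ones. -/
theorem qPoch_double {q s : ℂ} (hs : s ^ 2 = q) (n : ℕ) :
    (1 + q ^ n) * (qPoch q q n * qPoch (-1) q n * qPoch s q n * qPoch (-s) q n)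
      = 2 * qPoch q q (2 * n) := by
  induction n with
  | zero => norm_num [qPoch_zero]
  | succ n ih =>
    have e : (1 - s * q ^ n) * (1 + s * q ^ n) = 1 - q * q ^ (2 * n) := by
      rw [two_mul, pow_add]; linear_combination -(q ^ n * q ^ n) * hs
    rw [show 2 * (n + 1) = 2 * n + 1 + 1 by ring]
    simp only [qPoch_succ]
    have e2 : (1 - q * q ^ n) * (1 + q ^ (n + 1)) = 1 - q * q ^ (2 * n + 1) := by ring
    rw [← e2, ← e]
    linear_combination (1 - s * q ^ n) * (1 + s * q ^ n) * (1 - q * q ^ n) * (1 + q ^ (n + 1)) * ih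

/-- The sequence `α` of the Bailey pair. -/
noncomputable def baileyAlpha (q ω : ℂ) (r : ℕ) : ℂ :=
  (thetaTerm q ω r + thetaTerm q ω⁻¹ r) / 2

theorem sum_antidiagonal_baileyAlpha {q s ω : ℂ} (hq0 : q ≠ 0) (hq : ‖q‖ < 1) (hs : s ^ 2 = q)
    (hω : ω ^ 2 + ω + 1 = 0) (n : ℕ) :
    ∑ p ∈ antidiagonal n, baileyAlpha q ω p.1 * (qPoch q q p.2)⁻¹
        * (qPoch q q (2 * p.1 + p.2))⁻¹
      = qPoch ω q n * qPoch (ω ^ 2) q n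
        / (qPoch q q n * qPoch (-1) q n * qPoch s q n * qPoch (-s) q n) := by
  have h3 : ω * ω ^ 2 = 1 := by linear_combination (ω - 1) * hω
  have h0 : ω ≠ 0 := left_ne_zero_of_mul_eq_one h3
  have hinv : ω⁻¹ = ω ^ 2 := inv_eq_of_mul_eq_one_right h3
  have e0 : ∀ p : ℕ × ℕ, baileyAlpha q ω p.1 * (qPoch q q p.2)⁻¹
        * (qPoch q q (2 * p.1 + p.2))⁻¹
      = (thetaTerm q ω p.1 * (qPoch q q p.2)⁻¹ * (qPoch q q (2 * p.1 + p.2))⁻¹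
        + thetaTerm q ω⁻¹ p.1 * (qPoch q q p.2)⁻¹ * (qPoch q q (2 * p.1 + p.2))⁻¹) / 2 :=
    fun p => by rw [baileyAlpha]; ring
  rw [sum_congr rfl fun p _ => e0 p, ← sum_div, sum_add_distrib,
    sum_antidiagonal_thetaTerm hq0 hq h0, sum_antidiagonal_thetaTerm hq0 hq (inv_ne_zero h0),
    div_inv_eq_mul, div_eq_mul_inv q ω, hinv]
  have e1 : qPoch ω q n * (1 - ω * q ^ n) = (1 - ω) * qPoch (q * ω) q n := by
    rw [← qPoch_succ, qPoch_succ', mul_comm ω]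
  have e2 : qPoch (ω ^ 2) q n * (1 - ω ^ 2 * q ^ n) = (1 - ω ^ 2) * qPoch (q * ω ^ 2) q n := by
    rw [← qPoch_succ, qPoch_succ', mul_comm (ω ^ 2)]
  have e3 : qPoch ω q n * qPoch (q * ω ^ 2) q n + qPoch (ω ^ 2) q n * qPoch (q * ω) q n
      = qPoch ω q n * qPoch (ω ^ 2) q n * (1 + q ^ n) := by
    -- Here `3 = (1 - ω)(1 - ω²)` clears the denominators in `e1` and `e2`.
    have h : (3 : ℂ) ≠ 0 := by norm_num
    refine mul_left_cancel₀ h ?_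
    linear_combination (-(1 - ω) * qPoch ω q n) * e2 - ((1 - ω ^ 2) * qPoch (ω ^ 2) q n) * e1
      + ((qPoch ω q n * qPoch (q * ω ^ 2) q n + qPoch (ω ^ 2) q n * qPoch (q * ω) q n) * (2 - ω)
        - qPoch ω q n * qPoch (ω ^ 2) q n * (1 + q ^ n * (3 - 2 * ω))) * hω
  have hQ := qPoch_ne_zero (one_sub_mul_pow_ne_zero hq hq) (2 * n)
  have hd := qPoch_double hs n
  have hD : qPoch q q n * qPoch (-1) q n * qPoch s q n * qPoch (-s) q n ≠ 0 := by
    intro h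
    rw [h, mul_zero] at hd
    exact hQ (by simpa using hd.symm)
  rw [← add_mul, e3, eq_div_iff hD]
  field_simp
  linear_combination qPoch ω q n * qPoch (ω ^ 2) q n * hd

theorem norm_thetaTerm_le {q z : ℂ} (hq : ‖q‖ < 1) (hz : ‖z‖ = 1) (r : ℕ) :
    ‖thetaTerm q z r‖ ≤ 2 := by
  rw [thetaTerm]
  split_ifs
  · norm_num
  · have h1 : ‖q‖ ^ r ≤ 1 := pow_le_one₀ (norm_nonneg _) hq.le
    have h2 : ‖q‖ ^ r.choose 2 ≤ 1 := pow_le_one₀ (norm_nonneg _) hq.le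
    have h3 : ‖z ^ r + q ^ r * z⁻¹ ^ r‖ ≤ 2 := by
      refine (norm_add_le _ _).trans ?_
      simp only [norm_mul, norm_pow, norm_inv, hz, one_pow, inv_one]
      linarith
    simp only [norm_mul, norm_pow, norm_neg, norm_one, one_pow, one_mul]
    nlinarith [norm_nonneg (z ^ r + q ^ r * z⁻¹ ^ r)]

theorem norm_baileyAlpha_le {q ω : ℂ} (hq : ‖q‖ < 1) (hω : ‖ω‖ = 1) (r : ℕ) :
    ‖baileyAlpha q ω r‖ ≤ 2 := by
  have h1 := norm_thetaTerm_le hq hω r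
  have h2 := norm_thetaTerm_le (z := ω⁻¹) hq (by simp [hω]) r
  have := norm_add_le (thetaTerm q ω r) (thetaTerm q ω⁻¹ r)
  rw [baileyAlpha, norm_div, Complex.norm_ofNat]
  linarith

/-! ### Splitting the Bailey series modulo 3 -/

/-- The terms on the right-hand side of Bailey's lemma for the pair `baileyAlpha`. -/
noncomputable def baileyTerm (q a b ω : ℂ) (m : ℕ) : ℂ :=
  qPoch (q / a) q m * qPoch (q / b) q m * (qPoch b q m)⁻¹ * (qPoch a q m)⁻¹
    * (a * b / q) ^ m * baileyAlpha q ω m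

theorem summable_baileyTerm {q a b ω : ℂ} (hq : ‖q‖ < 1) (ha : ‖a‖ < 1) (hb : ‖b‖ < 1)
    (hx : ‖a * b / q‖ < 1) (hω : ‖ω‖ = 1) : Summable (baileyTerm q a b ω) := by
  obtain ⟨KU, hU0, hU⟩ := exists_norm_qPoch_le (q / a) q hq
  obtain ⟨KV, hV0, hV⟩ := exists_norm_qPoch_le (q / b) q hq
  obtain ⟨KB, hB0, hB⟩ := exists_norm_inv_qPoch_le hq (one_sub_mul_pow_ne_zero hb hq)
  obtain ⟨KA, hA0, hA⟩ := exists_norm_inv_qPoch_le hq (one_sub_mul_pow_ne_zero ha hq)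
  refine Summable.of_norm_bounded
    (((summable_geometric_of_lt_one (norm_nonneg (a * b / q)) hx).mul_left
      (KU * KV * KB * KA)).mul_right 2) fun m => ?_
  rw [baileyTerm]
  generalize a * b / q = x
  simp only [norm_mul, norm_pow]
  gcongr
  exacts [hU m, hV m, hB m, hA m, norm_baileyAlpha_le hq hω m]

theorem baileyTerm_zero (q a b ω : ℂ) : baileyTerm q a b ω 0 = 1 := by
  simp [baileyTerm, baileyAlpha, thetaTerm, qPoch_zero]

/-- Averaging over `ω` and `ω⁻¹` makes `α` factor with `1 + q ^ m`; the `-m` in the exponent comes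
from `(a * b / q) ^ m`. -/
theorem baileyTerm_of_ne_zero {q : ℂ} (a b ω : ℂ) (hq0 : q ≠ 0) {m : ℕ} (hm : m ≠ 0) :
    baileyTerm q a b ω m = (-1) ^ m * ((ω ^ m + ω⁻¹ ^ m) / 2)
      * rhsFactor q a b m * q ^ ((m.choose 2 : ℤ) - m) := by
  rw [zpow_sub₀ hq0, zpow_natCast, zpow_natCast]
  simp only [baileyTerm, baileyAlpha, thetaTerm, if_neg hm, inv_inv, rhsFactor, qPochs,
    List.map_cons, List.map_nil, List.prod_cons, List.prod_nil, mul_one, div_eq_mul_inv, mul_inv,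
    mul_pow, inv_pow]
  ring

theorem choose_two_cast (m : ℕ) : 2 * (m.choose 2 : ℤ) = m * (m - 1) := by
  induction m with
  | zero => simp
  | succ m ih =>
    rw [Nat.choose_succ_succ' m 1, Nat.choose_one_right]
    push_cast
    linarith

theorem baileyTerm_three_mul {q ω : ℂ} (a b : ℂ) (hq0 : q ≠ 0) (hω : ω ^ 3 = 1) {n : ℕ}
    (hn : n ≠ 0) :
    baileyTerm q a b ω (3 * n) = (-1) ^ n * rhsFactor q a b (3 * n)
      * q ^ ((9 * (n : ℤ) ^ 2 - 9 * n) / 2) := by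
  have e : (9 * (n : ℤ) ^ 2 - 9 * n) / 2 = ((3 * n).choose 2 : ℤ) - (3 * n : ℕ) := by
    have := choose_two_cast (3 * n)
    refine Int.ediv_eq_of_eq_mul_right two_ne_zero ?_
    push_cast at this ⊢
    linarith
  rw [baileyTerm_of_ne_zero a b ω hq0 (by omega), e, pow_mul (-1 : ℂ), pow_mul ω, pow_mul ω⁻¹,
    inv_pow, hω]
  norm_num

theorem baileyTerm_three_mul_sub_one {q ω : ℂ} (a b : ℂ) (hq0 : q ≠ 0) (hω : ω ^ 2 + ω + 1 = 0)
    {n : ℕ} (hn : n ≠ 0) :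
    baileyTerm q a b ω (3 * n - 1) = q ^ 2 / 2 * ((-1) ^ n * rhsFactor q a b (3 * n - 1)
      * q ^ ((9 * (n : ℤ) ^ 2 - 15 * n) / 2)) := by
  obtain ⟨n, rfl⟩ := Nat.exists_eq_succ_of_ne_zero hn
  have h3 : ω * ω ^ 2 = 1 := by linear_combination (ω - 1) * hω
  have h3' : ω ^ 3 = 1 := by rw [← h3]; ring
  have hinv : ω⁻¹ = ω ^ 2 := inv_eq_of_mul_eq_one_right h3
  -- With `n + 1` in place of `n`, the index is `3n + 2`; the summand `2` is the prefactor `q ^ 2`.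
  have e : ((3 * n + 2).choose 2 : ℤ) - (3 * n + 2 : ℕ)
      = 2 + (9 * ((n + 1 : ℕ) : ℤ) ^ 2 - 15 * (n + 1 : ℕ)) / 2 := by
    have := choose_two_cast (3 * n + 2)
    rw [← sub_eq_iff_eq_add', eq_comm]
    refine Int.ediv_eq_of_eq_mul_right two_ne_zero ?_
    push_cast at this ⊢
    linarith
  have e2 : 3 * (n + 1) - 1 = 3 * n + 2 := by omega
  have e3 : ω ^ (3 * n + 2) + ω⁻¹ ^ (3 * n + 2) = -1 := by
    rw [hinv, ← pow_mul, show 2 * (3 * n + 2) = 3 * (2 * n + 1) + 1 by ring, pow_add,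
      pow_add, pow_mul, pow_mul, h3']
    linear_combination hω
  have e4 : (-1 : ℂ) ^ (3 * n + 2) = (-1) ^ n := by
    rw [pow_add, pow_mul]; norm_num
  rw [Nat.succ_eq_add_one, e2, baileyTerm_of_ne_zero a b ω hq0 (by omega), e, e3, e4,
    zpow_add₀ hq0, pow_succ (-1 : ℂ), zpow_ofNat]
  ring

theorem baileyTerm_three_mul_add_one {q ω : ℂ} (a b : ℂ) (hq0 : q ≠ 0) (hω : ω ^ 2 + ω + 1 = 0)
    (n : ℕ) :
    baileyTerm q a b ω (3 * n + 1) = 1 / (2 * q) * ((-1) ^ n * rhsFactor q a b (3 * n + 1)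
      * q ^ ((9 * (n : ℤ) ^ 2 - 3 * n) / 2)) := by
  have h3 : ω * ω ^ 2 = 1 := by linear_combination (ω - 1) * hω
  have h3' : ω ^ 3 = 1 := by rw [← h3]; ring
  have hinv : ω⁻¹ = ω ^ 2 := inv_eq_of_mul_eq_one_right h3
  have e : ((3 * n + 1).choose 2 : ℤ) - (3 * n + 1 : ℕ)
      = -1 + (9 * (n : ℤ) ^ 2 - 3 * n) / 2 := by
    have := choose_two_cast (3 * n + 1)
    rw [← sub_eq_iff_eq_add', eq_comm]
    refine Int.ediv_eq_of_eq_mul_right two_ne_zero ?_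
    push_cast at this ⊢
    linarith
  have e3 : ω ^ (3 * n + 1) + ω⁻¹ ^ (3 * n + 1) = -1 := by
    rw [hinv, ← pow_mul, show 2 * (3 * n + 1) = 3 * (2 * n) + 2 by ring, pow_add,
      pow_add, pow_mul, pow_mul ω 3 (2 * n), h3']
    linear_combination hω
  have e4 : (-1 : ℂ) ^ (3 * n + 1) = -(-1) ^ n := by
    rw [pow_add, pow_mul]; norm_num
  rw [baileyTerm_of_ne_zero a b ω hq0 (by omega), e, e3, e4, zpow_add₀ hq0, zpow_neg_one]
  rw [one_div, mul_inv]
  ring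

theorem tsum_split_mod_three {f : ℕ → ℂ} (hf : Summable f) :
    ∑' n, f n = f 0 + ∑' n : ℕ+, f (3 * n) + ∑' n : ℕ+, f (3 * n - 1) + ∑' n, f (3 * n + 1) := by
  have h0 : Summable fun n => f (3 * n) := hf.comp_injective fun _ _ h => by simpa using h
  rw [Nat.sumByResidueClasses hf 3, tsum_pnat_eq_tsum_succ (f := fun n => f (3 * n)),
    tsum_pnat_eq_tsum_succ (f := fun n => f (3 * n - 1))]
  change ∑ j : Fin 3, ∑' m, f (ZMod.val (n := 3) j + 3 * m) = _
  have h1 := h0.tsum_eq_zero_add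
  rw [mul_zero] at h1
  rw [Fin.sum_univ_three, ← h1]
  change ∑' m, f (0 + 3 * m) + ∑' m, f (1 + 3 * m) + ∑' m, f (2 + 3 * m) = _
  have e : ∀ n, 3 * (n + 1) - 1 = 2 + 3 * n := fun n => by omega
  simp only [e, zero_add, add_comm 1 (3 * _)]
  ring

/-- In the exponents of `q` below, the integer division by `2` is exact, and the exponents
may be negative. Sums over `ℕ+` are the sums starting at `n = 1`. -/
theorem mainTheorem11 (q s a b ω : ℂ)
    (hq0 : q ≠ 0) (hq : ‖q‖ < 1) (hs : s ^ 2 = q)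
    (ha0 : a ≠ 0) (hb0 : b ≠ 0)
    (hab : max (max ‖a‖ ‖b‖) ‖a * b / q‖ < 1)
    (hω : ω = Complex.exp (2 * Real.pi * Complex.I / 3)) :
    Summable (lhsTerm q s a b ω) ∧
    Summable (fun n : ℕ+ => (-1 : ℂ) ^ (n : ℕ) * rhsFactor q a b (3 * (n : ℕ))
      * q ^ ((9 * (n : ℤ) ^ 2 - 9 * (n : ℤ)) / 2)) ∧
    Summable (fun n : ℕ+ => (-1 : ℂ) ^ (n : ℕ) * rhsFactor q a b (3 * (n : ℕ) - 1)
      * q ^ ((9 * (n : ℤ) ^ 2 - 15 * (n : ℤ)) / 2)) ∧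
    Summable (fun n : ℕ => (-1 : ℂ) ^ n * rhsFactor q a b (3 * n + 1)
      * q ^ ((9 * (n : ℤ) ^ 2 - 3 * (n : ℤ)) / 2)) ∧
    qPochsInf [q, a * b / q] q / qPochsInf [a, b] q * ∑' n : ℕ, lhsTerm q s a b ω n
      = 1
        + ∑' n : ℕ+, (-1 : ℂ) ^ (n : ℕ) * rhsFactor q a b (3 * (n : ℕ))
            * q ^ ((9 * (n : ℤ) ^ 2 - 9 * (n : ℤ)) / 2)
        + q ^ 2 / 2 * ∑' n : ℕ+, (-1 : ℂ) ^ (n : ℕ) * rhsFactor q a b (3 * (n : ℕ) - 1)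
            * q ^ ((9 * (n : ℤ) ^ 2 - 15 * (n : ℤ)) / 2)
        + 1 / (2 * q) * ∑' n : ℕ, (-1 : ℂ) ^ n * rhsFactor q a b (3 * n + 1)
            * q ^ ((9 * (n : ℤ) ^ 2 - 3 * (n : ℤ)) / 2) := by
  obtain ⟨hab', hx⟩ := max_lt_iff.1 hab
  obtain ⟨ha, hb⟩ := max_lt_iff.1 hab'
  have hprim : IsPrimitiveRoot ω 3 := by
    rw [hω]; exact_mod_cast Complex.isPrimitiveRoot_exp 3 (by norm_num)
  have hω3 : ω ^ 3 = 1 := hprim.pow_eq_one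
  have hω2 : ω ^ 2 + ω + 1 = 0 := by
    have h := hprim.geom_sum_eq_zero (by norm_num)
    simp only [sum_range_succ, sum_range_zero] at h
    linear_combination h
  have hωn : ‖ω‖ = 1 := hprim.norm'_eq_one (by norm_num)
  have hT := summable_baileyTerm hq ha hb hx hωn
  have hu : q / a * (a * b / q) = b := by field_simp
  have hv : q / b * (a * b / q) = a := by field_simp
  have huv : q / a * (q / b) * (a * b / q) = q := by field_simp
  have hα := norm_baileyAlpha_le (q := q) hq hωn
  have hL : ∀ n, lhsTerm q s a b ω n = qPoch (q / a) q n * qPoch (q / b) q n * (a * b / q) ^ n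
      * ∑ p ∈ antidiagonal n, baileyAlpha q ω p.1 * (qPoch q q p.2)⁻¹
        * (qPoch q q (2 * p.1 + p.2))⁻¹ := fun n => by
    rw [sum_antidiagonal_baileyAlpha hq0 hq hs hω2]
    simp only [lhsTerm, qPochs, List.map_cons, List.map_nil, List.prod_cons, List.prod_nil, mul_one]
    ring
  have hLs : Summable (lhsTerm q s a b ω) := by
    refine (hasSum_sum_antidiagonal (summable_bailey (u := q / a) (v := q / b) hq hx
      hα)).summable.congr fun n => ?_
    rw [hL, mul_sum]
    exact sum_congr rfl fun p hp => by rw [mem_antidiagonal.1 hp]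
  have hc2 : q ^ 2 / 2 ≠ 0 := by simpa using hq0
  have hc1 : 1 / (2 * q) ≠ 0 := by simpa using hq0
  have f0 : ∀ n : ℕ+, _ := fun n => baileyTerm_three_mul a b hq0 hω3 n.ne_zero
  have f2 : ∀ n : ℕ+, _ := fun n => baileyTerm_three_mul_sub_one a b hq0 hω2 n.ne_zero
  have f1 := baileyTerm_three_mul_add_one a b hq0 hω2
  have i0 : Function.Injective fun n : ℕ+ => 3 * (n : ℕ) := fun m n h => by
    simpa using h
  have i2 : Function.Injective fun n : ℕ+ => 3 * (n : ℕ) - 1 := fun m n h => by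
    have := m.pos
    have := n.pos
    exact PNat.eq (by simp only at h; omega)
  have i1 : Function.Injective fun n : ℕ => 3 * n + 1 := fun m n h => by simpa using h
  -- Each right-hand series is, up to a nonzero constant, a subseries of the summable Bailey series.
  refine ⟨hLs, (hT.comp_injective i0).congr fun n => f0 n,
    (summable_mul_left_iff hc2).1 ((hT.comp_injective i2).congr fun n => f2 n),
    (summable_mul_left_iff hc1).1 ((hT.comp_injective i1).congr fun n => f1 n), ?_⟩
  rw [← tsum_mul_left (a := q ^ 2 / 2), ← tsum_mul_left (a := 1 / (2 * q)),
    ← tsum_congr f0, ← tsum_congr f2, ← tsum_congr f1, ← baileyTerm_zero q a b ω,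
    ← tsum_split_mod_three hT]
  have hna := one_sub_mul_pow_ne_zero ha hq
  have hnb := one_sub_mul_pow_ne_zero hb hq
  have hB := bailey_lemma hq hx hα huv (by rwa [hu]) (by rwa [hv])
  rw [hu, hv, ← tsum_congr hL] at hB
  have hA0 := qPochInf_ne_zero hq hna
  have hB0 := qPochInf_ne_zero hq hnb
  simp only [qPochsInf, List.map_cons, List.map_nil, List.prod_cons, List.prod_nil, mul_one]
  rw [div_mul_eq_mul_div, hB, mul_comm (qPochInf b q), mul_div_cancel_left₀ _ (mul_ne_zero hA0 hB0)]
  rfl
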